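/- Call a function $\Psi\colon\mathbb R^n\to[0,\infty]$ admissible if $\Psi(0)=0$, $\Psi$ is continuous at $0$, $\Psi(x)>0$ for $x\ne 0$, $\Psi(x)\to\infty$ as $|x|\to\infty$, $\Psi(-x)=\Psi(x)$, and for every $x$ the function $t\mapsto\Psi(tx)$ is left-continuous on $(0,\infty)$ and $t\mapsto\Psi(tx)/t$ is non-decreasing on $(0,\infty)$. For an admissible $\Psi$ and $D>0$, a probability measure $\mu$ on $\mathbb R^n$, absolutely continuous with respect to Lebesgue measure, satisfies the modified logarithmic Sobolev inequality $mLSI(\Psi,D)$ if for every bounded locally Lipschitz function $f\colon\mathbb R^n\to(0,\infty)$, $$\mathrm{Ent}_\mu f^2\le D\int\Psi\Big(\frac{\nabla f}{f}\Big)f^2\,d\mu,\qquad \mathrm{Ent}_\mu g=\int g\log g\,d\mu-\int g\,d\mu\,\log\int g\,d\mu .$$ Let $\nu$ be the probability measure on $\mathbb R$ with distribution function $$F_\nu(x)=\begin{cases}\frac12 e^{-e^{-x}+1}, & x<0,\\ 1-\frac12 e^{-e^{x}+1}, & x\ge 0,\end{cases}$$ and write $\|f\|_p=\|f\|_{L^p(\nu)}=\left(\int|f|^p\,d\nu\right)^{1/p}\in[0,\infty]$.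 Then: 1. $\nu$ satisfies $mLSI(\Psi,2)$ with $\Psi(x)=|x|$. 2. For every locally Lipschitz $f\colon\mathbb R\to\mathbb R$ and every real $p>1$, $\ \|f\|_p\le\|f\|_1+\log(p)\,\|f'\|_p$. 3. For $f(x)=x$ and every real $p\ge 1$, $\ \|f\|_p\ge\frac{\log p}{2e}$. 4. Consequently the factor $\log p$ in 2 has the optimal order as $p\to\infty$: if $C\ge0$ and $c\colon\mathbb R\to[0,\infty)$ are such that, for all sufficiently large $p$, $\ \|f\|_p\le C\|f\|_1+c(p)\|f'\|_p$ holds for all locally Lipschitz $f\colon\mathbb R\to\mathbb R$, then $\log p=O(c(p))$ as $p\to\infty$. -/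

import Mathlib

open MeasureTheory ProbabilityTheory Filter Topology Asymptotics
open scoped ENNReal NNReal

/-- Condition (C) on a generalized Orlicz function `Ψ : E → [0, ∞]`. -/
structure ConditionC {E : Type*} [NormedAddCommGroup E] [InnerProductSpace ℝ E]
    (Ψ : E → ℝ≥0∞) : Prop where
  map_zero : Ψ 0 = 0
  continuousAt_zero : ContinuousAt Ψ 0
  pos : ∀ x, x ≠ 0 → 0 < Ψ x
  tendsto_top : Tendsto Ψ (comap norm atTop) (𝓝 ∞)
  left_continuous : ∀ x, ∀ t : ℝ, 0 < t →
    ContinuousWithinAt (fun s : ℝ => Ψ (s • x)) (Set.Iio t) t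
  monotone_div : ∀ x, MonotoneOn (fun t : ℝ => Ψ (t • x) / ENNReal.ofReal t) (Set.Ioi 0)
  symm : ∀ x, Ψ (-x) = Ψ x

/-- The entropy `Ent_μ g = 𝔼 g log g - 𝔼 g · log 𝔼 g`. It is used below only for probability
measures and for bounded continuous `g > 0`, for which both expectations are finite and the
entropy is nonnegative. -/
noncomputable def entropy {E : Type*} [MeasurableSpace E] (μ : Measure E) (g : E → ℝ) : ℝ :=
  (∫ x, g x * Real.log (g x) ∂μ) - (∫ x, g x ∂μ) * Real.log (∫ x, g x ∂μ)

/-- The modified logarithmic Sobolev inequality `mLSI(Ψ, D)` for an absolutely continuous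
probability measure `μ` on a Euclidean space. The right-hand side may be infinite. -/
structure ModifiedLSI {E : Type*} [NormedAddCommGroup E] [InnerProductSpace ℝ E]
    [FiniteDimensional ℝ E] [MeasureSpace E] (μ : Measure E) (Ψ : E → ℝ≥0∞) (D : ℝ) :
    Prop where
  isProbabilityMeasure : IsProbabilityMeasure μ
  absolutelyContinuous : μ ≪ volume
  conditionC : ConditionC Ψ
  pos : 0 < D
  inequality : ∀ f : E → ℝ, LocallyLipschitz f → (∀ x, 0 < f x) → (∃ M, ∀ x, f x ≤ M) →
    ENNReal.ofReal (entropy μ (fun x => f x ^ 2)) ≤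
      ENNReal.ofReal D *
        ∫⁻ x, Ψ ((f x)⁻¹ • @gradient ℝ E _ _ _ (FiniteDimensional.complete ℝ E) f x) *
          ENNReal.ofReal (f x ^ 2) ∂μ

/-- The distribution function of `ν`. -/
noncomputable def nuCDF (x : ℝ) : ℝ :=
  if x < 0 then 1 / 2 * Real.exp (-Real.exp (-x) + 1)
  else 1 - 1 / 2 * Real.exp (-Real.exp x + 1)

theorem nuCDF_monotone : Monotone nuCDF := by
  intro x y hxy
  have h0 : ∀ z : ℝ, 0 ≤ z → Real.exp (-Real.exp z + 1) ≤ 1 := by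
    intro z hz
    rw [Real.exp_le_one_iff]
    linarith [Real.one_le_exp hz]
  unfold nuCDF
  split_ifs with hx hy hy
  · gcongr
  · linarith [h0 (-x) (by linarith), h0 y (by linarith)]
  · exact absurd (lt_of_le_of_lt hxy hy) hx
  · gcongr

theorem nuCDF_continuous : Continuous nuCDF := by
  unfold nuCDF
  refine Continuous.if (fun a ha => ?_) (by fun_prop) (by fun_prop)
  have ha' : a = 0 := by
    have h := frontier_lt_subset_eq continuous_id continuous_const ha
    simpa using h
  subst ha'
  norm_num

theorem nuCDF_tendsto_atBot : Tendsto nuCDF atBot (𝓝 0) := by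
  have h : Tendsto (fun x : ℝ => 1 / 2 * Real.exp (-Real.exp (-x) + 1)) atBot (𝓝 (1 / 2 * 0)) :=
    Tendsto.const_mul _ (Real.tendsto_exp_atBot.comp (tendsto_atBot_add_const_right _ _
      (tendsto_neg_atTop_atBot.comp (Real.tendsto_exp_atTop.comp tendsto_neg_atBot_atTop))))
  rw [mul_zero] at h
  refine h.congr' ?_
  filter_upwards [eventually_lt_atBot (0 : ℝ)] with x hx
  simp [nuCDF, hx]

theorem nuCDF_tendsto_atTop : Tendsto nuCDF atTop (𝓝 1) := by
  have h : Tendsto (fun x : ℝ => 1 - 1 / 2 * Real.exp (-Real.exp x + 1)) atTop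
      (𝓝 (1 - 1 / 2 * 0)) :=
    Tendsto.const_sub _ (Tendsto.const_mul _ (Real.tendsto_exp_atBot.comp
      (tendsto_atBot_add_const_right _ _
        (tendsto_neg_atTop_atBot.comp Real.tendsto_exp_atTop))))
  rw [mul_zero, sub_zero] at h
  refine h.congr' ?_
  filter_upwards [eventually_ge_atTop (0 : ℝ)] with x hx
  simp [nuCDF, not_lt.mpr hx]

noncomputable def nuStieltjes : StieltjesFunction ℝ where
  toFun := nuCDF
  mono' := nuCDF_monotone
  right_continuous' := fun _ => nuCDF_continuous.continuousAt.continuousWithinAt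

/-- The probability measure on `ℝ` whose distribution function is `nuCDF`. -/
noncomputable def nu : Measure ℝ := nuStieltjes.measure

theorem nu_isProbabilityMeasure : IsProbabilityMeasure nu :=
  nuStieltjes.isProbabilityMeasure nuCDF_tendsto_atBot nuCDF_tendsto_atTop

theorem cdf_nu (x : ℝ) : cdf nu x = nuCDF x := by
  have h := cdf_measure_stieltjesFunction nuStieltjes nuCDF_tendsto_atBot nuCDF_tendsto_atTop
  exact congrArg (fun F : StieltjesFunction ℝ => F x) h

/-! Everything rests on one L¹ inequality, Ent_ν g ≤ ∫ |g'| dν for bounded locally Lipschitz g > 0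
(`entropy_nu_le_integral_deriv`). It reflects isoperimetry: at x ≥ 0 the tail v = 1 - F(x) equals
(e/2) exp(-eˣ) and the density w equals v eˣ, which is of order v log(1/v).

To prove it, put h = log(g / ∫ g dν), so that ∫ eʰ dν = 1 and Ent g = ∫ g h dν. Young's inequality
for the exponential and the tail formula give ∫_x^y h dν ≤ w(x) + w(y) on every interval
(`integral_mul_nuDensity_le`). Thus a primitive H of h w has increments H(y) - H(x) ≤ w(x) + w(y).
Instead of a coarea formula, `intervalIntegral_mul_deriv_le_of_increment_le` adds to H a
nondecreasing M with |H + M| ≤ w. As g ≥ 0, this only increases ∫ g H', and integration by parts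
bounds the result by ∫ |g'| w plus boundary terms that vanish at infinity.

Taking g = f² gives the modified log-Sobolev inequality. Taking g = fʳ and applying Hölder gives
Ent(fʳ) ≤ r ‖f‖_r^(r-1) ‖f'‖_p for 1 < r ≤ p. Since d/dr ‖f‖_r = r⁻² ‖f‖_r^(1-r) Ent(fʳ), the
derivative is at most ‖f'‖_p / r, and integrating over [1, p] produces log p. Truncation and Fatou
remove the bounds on f.

For optimality, ν(|x| ≥ log p) ≥ e^(1-p), so Chebyshev's inequality at level log p bounds ‖x‖_p
below, while the derivative of x has norm 1 and ‖x‖_1 is finite. -/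

/-! ### Integration by parts under a bound on increments -/

/-- A point t ≤ x either already competes in the supremum up to y, or lies in [y, x], where φ(t)
exceeds φ(y) by at most L |x - y|. This makes the running supremum absolutely continuous, as
integration by parts requires. -/
theorem LipschitzOnWith.sSup_image_Icc {φ : ℝ → ℝ} {L : ℝ≥0} {a b : ℝ}
    (hφ : LipschitzOnWith L φ (Set.Icc a b)) :
    LipschitzOnWith L (fun x => sSup (φ '' Set.Icc a x)) (Set.Icc a b) := by
  have hbdd : ∀ x ∈ Set.Icc a b, BddAbove (φ '' Set.Icc a x) := fun x hx =>
    (isCompact_Icc.image_of_continuousOn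
      (hφ.continuousOn.mono (Set.Icc_subset_Icc_right hx.2))).bddAbove
  refine LipschitzOnWith.of_le_add_mul L fun x hx y hy => ?_
  refine csSup_le ((Set.nonempty_Icc.2 hx.1).image φ) ?_
  rintro _ ⟨t, ht, rfl⟩
  have hL : 0 ≤ (L : ℝ) := L.2
  rcases le_total t y with hty | hty
  · have h1 := le_csSup (hbdd y hy) (Set.mem_image_of_mem φ (⟨ht.1, hty⟩ : t ∈ Set.Icc a y))
    have h2 := mul_nonneg hL (dist_nonneg (x := x) (y := y))
    linarith
  · have h1 := le_csSup (hbdd y hy) (Set.mem_image_of_mem φ (⟨hy.1, le_rfl⟩ : y ∈ Set.Icc a y))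
    have h2 := hφ.le_add_mul ⟨ht.1, ht.2.trans hx.2⟩ hy
    have h3 : dist t y ≤ dist x y := by
      rw [Real.dist_eq, Real.dist_eq, abs_of_nonneg (by linarith), abs_of_nonneg (by linarith [ht.2])]
      linarith [ht.2]
    have h4 := mul_le_mul_of_nonneg_left h3 hL
    linarith

/-- The running supremum M of -w - H is the least nondecreasing function with M + H ≥ -w. The
increment hypothesis says exactly that also M + H ≤ w. Since ∫ g M' ≥ 0, H may be replaced by H + M
before integrating by parts. -/
theorem intervalIntegral_mul_deriv_le_of_increment_le {g H w : ℝ → ℝ} {a b : ℝ} (hab : a ≤ b)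
    {Lg LH Lw : ℝ≥0} (hg : LipschitzOnWith Lg g (Set.Icc a b))
    (hH : LipschitzOnWith LH H (Set.Icc a b)) (hw : LipschitzOnWith Lw w (Set.Icc a b))
    (hg0 : ∀ x ∈ Set.Icc a b, 0 ≤ g x)
    (hinc : ∀ x ∈ Set.Icc a b, ∀ y ∈ Set.Icc a b, x ≤ y → H y - H x ≤ w x + w y) :
    ∫ x in a..b, g x * deriv H x ≤ g a * w a + g b * w b + ∫ x in a..b, |deriv g x| * w x := by
  set φ : ℝ → ℝ := fun x => -w x - H x with hφ
  set M : ℝ → ℝ := fun x => sSup (φ '' Set.Icc a x) with hMdef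
  have hφL : LipschitzOnWith (Lw + LH) φ (Set.Icc a b) := hw.neg.sub hH
  have hML : LipschitzOnWith (Lw + LH) M (Set.Icc a b) := hφL.sSup_image_Icc
  have hbdd : ∀ x ∈ Set.Icc a b, BddAbove (φ '' Set.Icc a x) := fun x hx =>
    (isCompact_Icc.image_of_continuousOn
      (hφL.continuousOn.mono (Set.Icc_subset_Icc_right hx.2))).bddAbove
  have hMmono : MonotoneOn M (Set.Icc a b) := fun x hx y hy hxy =>
    csSup_le_csSup (hbdd y hy) ((Set.nonempty_Icc.2 hx.1).image φ)
      (Set.image_mono (Set.Icc_subset_Icc_right hxy))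
  have hKlow : ∀ x ∈ Set.Icc a b, -w x ≤ M x + H x := fun x hx => by
    have := le_csSup (hbdd x hx) (Set.mem_image_of_mem φ (⟨hx.1, le_rfl⟩ : x ∈ Set.Icc a x))
    simp only [hφ] at this
    simp only [hMdef]
    linarith
  have hKup : ∀ x ∈ Set.Icc a b, M x + H x ≤ w x := fun x hx => by
    have : M x ≤ w x - H x := by
      refine csSup_le ((Set.nonempty_Icc.2 hx.1).image φ) ?_
      rintro _ ⟨t, ht, rfl⟩
      have := hinc t ⟨ht.1, ht.2.trans hx.2⟩ x hx ht.2
      simp only [hφ]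
      linarith
    linarith
  rw [← Set.uIcc_of_le hab] at hg hH hw hML
  have ag := hg.absolutelyContinuousOnInterval
  have aH := hH.absolutelyContinuousOnInterval
  have aM := hML.absolutelyContinuousOnInterval
  have e1 := ag.integral_mul_deriv_eq_deriv_mul aH
  have e2 := ag.integral_mul_deriv_eq_deriv_mul aM
  have i1 := ag.intervalIntegrable_deriv.mul_continuousOn aH.continuousOn
  have i2 := ag.intervalIntegrable_deriv.mul_continuousOn aM.continuousOn
  have i3 := ag.intervalIntegrable_deriv.abs.mul_continuousOn hw.continuousOn
  have hpos : 0 ≤ ∫ x in a..b, g x * deriv M x := by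
    rw [intervalIntegral.integral_of_le hab, integral_Ioc_eq_integral_Ioo]
    refine setIntegral_nonneg measurableSet_Ioo fun x hx => ?_
    refine mul_nonneg (hg0 x (Set.Ioo_subset_Icc_self hx)) ?_
    have hn : Set.Icc a b ∈ 𝓝 x := Icc_mem_nhds hx.1 hx.2
    rw [← derivWithin_of_mem_nhds hn]
    exact hMmono.derivWithin_nonneg
  have hle : -∫ x in a..b, (deriv g x * H x + deriv g x * M x) ≤
      ∫ x in a..b, |deriv g x| * w x := by
    rw [← intervalIntegral.integral_neg]
    refine intervalIntegral.integral_mono_on hab (i1.add i2).neg i3 fun x hx => ?_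
    have hK : |M x + H x| ≤ w x := abs_le.2 ⟨hKlow x hx, hKup x hx⟩
    calc -(deriv g x * H x + deriv g x * M x) = -(deriv g x * (M x + H x)) := by ring
      _ ≤ |deriv g x * (M x + H x)| := neg_le_abs _
      _ = |deriv g x| * |M x + H x| := abs_mul _ _
      _ ≤ |deriv g x| * w x := mul_le_mul_of_nonneg_left hK (abs_nonneg _)
  rw [intervalIntegral.integral_add i1 i2] at hle
  have ha : a ∈ Set.Icc a b := ⟨le_rfl, hab⟩
  have hb : b ∈ Set.Icc a b := ⟨hab, le_rfl⟩
  have b1 := mul_le_mul_of_nonneg_left (hKup b hb) (hg0 b hb)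
  have b2 := mul_le_mul_of_nonneg_left (hKlow a ha) (hg0 a ha)
  linarith

/-! ### The density of ν and the isoperimetry of intervals -/

/-- The density of `nu` with respect to Lebesgue measure. -/
noncomputable def nuDensity (x : ℝ) : ℝ := 1 / 2 * Real.exp (|x| + 1 - Real.exp |x|)

theorem nuDensity_pos (x : ℝ) : 0 < nuDensity x := by unfold nuDensity; positivity

theorem continuous_nuDensity : Continuous nuDensity := by unfold nuDensity; fun_prop

theorem locallyLipschitz_nuDensity : LocallyLipschitz nuDensity := by
  have h1 : LocallyLipschitz (fun y : ℝ => 1 / 2 * Real.exp (y + 1 - Real.exp y)) :=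
    ContDiff.locallyLipschitz (𝕂 := ℝ) (by fun_prop)
  exact h1.comp (lipschitzWith_one_norm (E := ℝ)).locallyLipschitz

theorem nuCDF_of_nonneg {x : ℝ} (hx : 0 ≤ x) :
    nuCDF x = 1 - 1 / 2 * Real.exp (-Real.exp x + 1) := by
  simp [nuCDF, not_lt.mpr hx]

theorem nuCDF_of_nonpos {x : ℝ} (hx : x ≤ 0) :
    nuCDF x = 1 / 2 * Real.exp (-Real.exp (-x) + 1) := by
  rcases hx.lt_or_eq with h | rfl
  · simp [nuCDF, h]
  · norm_num [nuCDF]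

theorem hasDerivAt_nuCDF {x : ℝ} (hx : x ≠ 0) : HasDerivAt nuCDF (nuDensity x) x := by
  rcases lt_or_gt_of_ne hx with h | h
  · have h1 : HasDerivAt (fun x : ℝ => 1 / 2 * Real.exp (-Real.exp (-x) + 1))
        (1 / 2 * (Real.exp (-Real.exp (-x) + 1) * -(Real.exp (-x) * -1))) x :=
      (((hasDerivAt_neg x).exp.neg.add_const 1).exp).const_mul _
    refine (h1.congr_of_eventuallyEq ?_).congr_deriv ?_
    · filter_upwards [Iio_mem_nhds h] with y hy using nuCDF_of_nonpos (le_of_lt hy)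
    · rw [nuDensity, abs_of_neg h]
      rw [show -x + 1 - Real.exp (-x) = (-Real.exp (-x) + 1) + -x by ring,
        Real.exp_add (-Real.exp (-x) + 1)]
      ring
  · have h1 : HasDerivAt (fun x : ℝ => 1 - 1 / 2 * Real.exp (-Real.exp x + 1))
        (-(1 / 2 * (Real.exp (-Real.exp x + 1) * -(Real.exp x)))) x :=
      ((((Real.hasDerivAt_exp x).neg.add_const 1).exp).const_mul _).const_sub _
    refine (h1.congr_of_eventuallyEq ?_).congr_deriv ?_
    · filter_upwards [Ioi_mem_nhds h] with y hy using nuCDF_of_nonneg (le_of_lt hy)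
    · rw [nuDensity, abs_of_pos h]
      rw [show x + 1 - Real.exp x = (-Real.exp x + 1) + x by ring,
        Real.exp_add (-Real.exp x + 1)]
      ring

theorem integral_nuDensity (a b : ℝ) : ∫ x in a..b, nuDensity x = nuCDF b - nuCDF a :=
  integral_eq_of_hasDerivAt_off_countable nuCDF nuDensity (Set.countable_singleton 0)
    nuCDF_continuous.continuousOn (fun _ hx => hasDerivAt_nuCDF hx.2)
    (continuous_nuDensity.intervalIntegrable a b)

theorem nu_eq_withDensity :
    nu = volume.withDensity (fun x => ENNReal.ofReal (nuDensity x)) := by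
  have := nu_isProbabilityMeasure
  refine Measure.ext_of_Ioc _ _ fun a b hab => ?_
  rw [withDensity_apply _ measurableSet_Ioc, nu, StieltjesFunction.measure_Ioc,
    ← ofReal_integral_eq_lintegral_ofReal
      (continuous_nuDensity.integrableOn_Icc.mono_set Set.Ioc_subset_Icc_self)
      (ae_of_all _ fun x => (nuDensity_pos x).le),
    ← intervalIntegral.integral_of_le hab.le, integral_nuDensity]
  rfl

theorem nu_absolutelyContinuous : nu ≪ volume := by
  rw [nu_eq_withDensity]
  exact withDensity_absolutelyContinuous _ _

theorem integral_nu (f : ℝ → ℝ) : ∫ x, f x ∂nu = ∫ x, f x * nuDensity x := by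
  rw [nu_eq_withDensity, integral_withDensity_eq_integral_toReal_smul
    (by have := continuous_nuDensity.measurable; fun_prop) (by simp)]
  refine integral_congr_ae (ae_of_all _ fun x => ?_)
  simp [ENNReal.toReal_ofReal (nuDensity_pos x).le, mul_comm]

theorem integrable_nu_iff {f : ℝ → ℝ} :
    Integrable f nu ↔ Integrable (fun x => f x * nuDensity x) := by
  rw [nu_eq_withDensity, integrable_withDensity_iff
    (by have := continuous_nuDensity.measurable; fun_prop) (by simp)]
  simp [ENNReal.toReal_ofReal (nuDensity_pos _).le]

theorem tendsto_nuDensity_atTop : Tendsto nuDensity atTop (𝓝 0) := by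
  have h1 : Tendsto (fun x : ℝ => 1 / 2 * Real.exp 1 * (Real.exp x ^ 1 * Real.exp (-Real.exp x)))
      atTop (𝓝 (1 / 2 * Real.exp 1 * 0)) :=
    ((Real.tendsto_pow_mul_exp_neg_atTop_nhds_zero 1).comp Real.tendsto_exp_atTop).const_mul _
  rw [mul_zero] at h1
  refine h1.congr' ?_
  filter_upwards [eventually_ge_atTop 0] with x hx
  rw [nuDensity, abs_of_nonneg hx, show x + 1 - Real.exp x = 1 + (x + -Real.exp x) by ring,
    Real.exp_add, Real.exp_add, pow_one, mul_assoc]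

theorem nuDensity_neg (x : ℝ) : nuDensity (-x) = nuDensity x := by simp [nuDensity]

theorem nuDensity_of_nonneg {x : ℝ} (hx : 0 ≤ x) :
    nuDensity x = (1 - nuCDF x) * Real.exp x := by
  rw [nuDensity, nuCDF_of_nonneg hx, abs_of_nonneg hx,
    show x + 1 - Real.exp x = (-Real.exp x + 1) + x by ring, Real.exp_add (-Real.exp x + 1)]
  ring

theorem nuDensity_of_nonpos {x : ℝ} (hx : x ≤ 0) :
    nuDensity x = nuCDF x * Real.exp (-x) := by
  rw [nuDensity, nuCDF_of_nonpos hx, abs_of_nonpos hx,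
    show -x + 1 - Real.exp (-x) = (-Real.exp (-x) + 1) + -x by ring,
    Real.exp_add (-Real.exp (-x) + 1)]
  ring

theorem nuCDF_nonneg (x : ℝ) : 0 ≤ nuCDF x := by rw [← cdf_nu]; exact cdf_nonneg _ _

theorem nuCDF_le_one (x : ℝ) : nuCDF x ≤ 1 := by rw [← cdf_nu]; exact cdf_le_one _ _

/-- The isoperimetric-type inequality for `nu`: test functions of exponential mass at most one
have small integrals over intervals. -/
theorem integral_mul_nuDensity_le {h : ℝ → ℝ} (hc : Continuous h)
    (hint : Integrable (fun x => Real.exp (h x)) nu) (hone : ∫ x, Real.exp (h x) ∂nu ≤ 1)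
    {a b : ℝ} (hab : a ≤ b) :
    ∫ x in a..b, h x * nuDensity x ≤ nuDensity a + nuDensity b := by
  have hd := continuous_nuDensity
  have hmass : ∫ x in a..b, Real.exp (h x) * nuDensity x ≤ 1 := by
    rw [integral_nu] at hone
    rw [intervalIntegral.integral_of_le hab]
    exact (setIntegral_le_integral (integrable_nu_iff.1 hint)
      (ae_of_all _ fun x => mul_nonneg (Real.exp_pos _).le (nuDensity_pos x).le)).trans hone
  -- Young's inequality h ≤ exp(h - k) + k - 1, integrated over [a, b]; the parameter k is chosen
  -- according to the position of the interval.
  have key : ∀ k : ℝ, ∫ x in a..b, h x * nuDensity x ≤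
      Real.exp (-k) + (k - 1) * (nuCDF b - nuCDF a) := fun k => by
    calc ∫ x in a..b, h x * nuDensity x
        ≤ ∫ x in a..b, (Real.exp (-k) * (Real.exp (h x) * nuDensity x) +
            (k - 1) * nuDensity x) := by
          refine intervalIntegral.integral_mono_on hab
            (Continuous.intervalIntegrable (by fun_prop) _ _)
            (Continuous.intervalIntegrable (by fun_prop) _ _) fun x _ => ?_
          have h1 := Real.add_one_le_exp (h x + -k)
          rw [Real.exp_add] at h1
          have h2 := mul_le_mul_of_nonneg_right h1 (nuDensity_pos x).le
          linarith
      _ = Real.exp (-k) * (∫ x in a..b, Real.exp (h x) * nuDensity x) +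
            (k - 1) * (nuCDF b - nuCDF a) := by
          rw [intervalIntegral.integral_add (Continuous.intervalIntegrable (by fun_prop) _ _)
            (Continuous.intervalIntegrable (by fun_prop) _ _),
            intervalIntegral.integral_const_mul, intervalIntegral.integral_const_mul,
            integral_nuDensity]
      _ ≤ _ := by
          have := mul_le_mul_of_nonneg_left hmass (Real.exp_pos (-k)).le
          linarith
  -- For an interval on one side of 0, y is the distance from 0 to the nearer endpoint and k = exp
  -- y. With v the tail beyond y, e ≥ 2 gives exp(-k) ≤ v, so the bound is at most v + (k - 1) v = k
  -- v, the density at that endpoint alone.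
  have hbound : ∀ y s v : ℝ, 0 ≤ y → 1 - nuCDF y = v → s ≤ v →
      Real.exp (-Real.exp y) + (Real.exp y - 1) * s ≤ nuDensity y := fun y s v hy hv hs => by
    have h1 : 1 ≤ Real.exp y := Real.one_le_exp hy
    have h2 : Real.exp (-Real.exp y) ≤ v := by
      rw [← hv, nuCDF_of_nonneg hy, Real.exp_add]
      have : 2 ≤ Real.exp 1 := by linarith [Real.add_one_le_exp (1 : ℝ)]
      nlinarith [Real.exp_pos (-Real.exp y)]
    rw [nuDensity_of_nonneg hy, hv]
    nlinarith [mul_le_mul_of_nonneg_left hs (sub_nonneg.2 h1)]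
  rcases le_total 0 a with ha | ha
  · have h1 := hbound a (nuCDF b - nuCDF a) _ ha rfl (by linarith [nuCDF_le_one b])
    linarith [key (Real.exp a), nuDensity_pos b]
  · rcases le_total b 0 with hb | hb
    · have hs : 1 - nuCDF (-b) = nuCDF b := by
        rw [nuCDF_of_nonneg (neg_nonneg.2 hb), nuCDF_of_nonpos hb]; ring
      have h1 := hbound (-b) (nuCDF b - nuCDF a) _ (neg_nonneg.2 hb) hs
        (by linarith [nuCDF_nonneg a])
      rw [nuDensity_neg] at h1
      linarith [key (Real.exp (-b)), nuDensity_pos a]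
    -- An interval containing 0: with k = 0 the bound is the mass outside the interval, and each of
    -- the two tails is at most the density at its endpoint.
    · have h1 := key 0
      rw [neg_zero, Real.exp_zero] at h1
      have h2 : nuCDF a ≤ nuDensity a := by
        rw [nuDensity_of_nonpos ha]
        exact le_mul_of_one_le_right (nuCDF_nonneg a) (Real.one_le_exp (by linarith))
      have h3 : 1 - nuCDF b ≤ nuDensity b := by
        rw [nuDensity_of_nonneg hb]
        exact le_mul_of_one_le_right (by linarith [nuCDF_le_one b]) (Real.one_le_exp hb)
      linarith

/-! ### The L¹ entropy inequality -/

theorem integrable_nu_of_bounded {f : ℝ → ℝ} (hf : Continuous f) {B : ℝ} (hB : ∀ x, |f x| ≤ B) :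
    Integrable f nu := by
  have := nu_isProbabilityMeasure
  exact Integrable.of_bound hf.aestronglyMeasurable B (ae_of_all _ hB)

theorem integral_nu_pos {g : ℝ → ℝ} (hg : Integrable g nu) (hpos : ∀ x, 0 < g x) :
    0 < ∫ x, g x ∂nu := by
  have := nu_isProbabilityMeasure
  rw [integral_pos_iff_support_of_nonneg (fun x => (hpos x).le) hg]
  have : Function.support g = Set.univ := Set.eq_univ_of_forall fun x => (hpos x).ne'
  simp [this]

theorem entropy_nu_le_integral_deriv {g : ℝ → ℝ} (hL : LocallyLipschitz g)
    (hpos : ∀ x, 0 < g x) {B : ℝ} (hB : ∀ x, g x ≤ B)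
    (hd : Integrable (deriv g) nu) :
    entropy nu g ≤ ∫ x, |deriv g x| ∂nu := by
  have hP := nu_isProbabilityMeasure
  have hgc : Continuous g := hL.continuous
  have hdc := continuous_nuDensity
  have hgi : Integrable g nu := integrable_nu_of_bounded hgc (B := B) fun x => by
    rw [abs_of_pos (hpos x)]; exact hB x
  have hZ := integral_nu_pos hgi hpos
  set Z := ∫ x, g x ∂nu with hZdef
  have hlog : Continuous fun x => Real.log (g x) := hgc.log fun x => (hpos x).ne'
  have hgl : Integrable (fun x => g x * Real.log (g x)) nu := by
    obtain ⟨C, hC⟩ := (isCompact_Icc (a := 0) (b := B)).exists_bound_of_continuousOn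
      Real.continuous_mul_log.continuousOn
    exact integrable_nu_of_bounded (by fun_prop) fun x => hC (g x) ⟨(hpos x).le, hB x⟩
  set h : ℝ → ℝ := fun x => Real.log (g x) - Real.log Z with hh
  have hhc : Continuous h := hlog.sub continuous_const
  have hexp : (fun x => Real.exp (h x)) = fun x => g x / Z := by
    ext x
    rw [hh, Real.exp_sub, Real.exp_log (hpos x), Real.exp_log hZ]
  have hent : entropy nu g = ∫ x, g x * h x ∂nu := by
    simp only [hh, mul_sub]
    rw [integral_sub hgl (hgi.mul_const _), integral_mul_const]
    rfl
  have hghi : Integrable (fun x => g x * h x) nu := by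
    simp only [hh, mul_sub]
    exact hgl.sub (hgi.mul_const _)
  set H : ℝ → ℝ := fun x => ∫ t in (0 : ℝ)..x, h t * nuDensity t with hHdef
  have hc : Continuous fun t => h t * nuDensity t := by fun_prop
  have hHd : ∀ x, HasDerivAt H (h x * nuDensity x) x := fun x =>
    (hc.integral_hasStrictDerivAt 0 x).hasDerivAt
  have hderivH : deriv H = fun x => h x * nuDensity x := funext fun x => (hHd x).deriv
  have hHL : LocallyLipschitz H := ContDiff.locallyLipschitz (𝕂 := ℝ)
    (contDiff_one_iff_deriv.2 ⟨fun x => (hHd x).differentiableAt, by rw [hderivH]; exact hc⟩)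
  -- On a compact interval all functions involved are Lipschitz. The boundary terms are at most B
  -- times the density at ±R, which tends to 0.
  have hstep : ∀ R : ℝ, 0 ≤ R → ∫ x in -R..R, g x * h x * nuDensity x ≤
      2 * B * nuDensity R + ∫ x, |deriv g x| ∂nu := fun R hR => by
    have hRR : -R ≤ R := by linarith
    obtain ⟨Lg, hLg⟩ := (hL.locallyLipschitzOn
      (s := Set.Icc (-R) R)).exists_lipschitzOnWith_of_compact isCompact_Icc
    obtain ⟨LH, hLH⟩ := (hHL.locallyLipschitzOn
      (s := Set.Icc (-R) R)).exists_lipschitzOnWith_of_compact isCompact_Icc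
    obtain ⟨Lw, hLw⟩ := (locallyLipschitz_nuDensity.locallyLipschitzOn
      (s := Set.Icc (-R) R)).exists_lipschitzOnWith_of_compact isCompact_Icc
    have h1 := intervalIntegral_mul_deriv_le_of_increment_le hRR hLg hLH hLw
      (fun x _ => (hpos x).le) fun x _ y _ hxy => by
        have e : H y - H x = ∫ t in x..y, h t * nuDensity t :=
          intervalIntegral.integral_interval_sub_left (hc.intervalIntegrable _ _)
            (hc.intervalIntegrable _ _)
        rw [e]
        refine integral_mul_nuDensity_le hhc ?_ ?_ hxy
        · rw [hexp]; exact hgi.div_const _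
        · rw [hexp, integral_div, ← hZdef, div_self hZ.ne']
    rw [hderivH, nuDensity_neg] at h1
    have h2 : ∫ x in -R..R, |deriv g x| * nuDensity x ≤ ∫ x, |deriv g x| ∂nu := by
      rw [intervalIntegral.integral_of_le hRR, integral_nu]
      exact setIntegral_le_integral (integrable_nu_iff.1 hd.abs)
        (ae_of_all _ fun x => mul_nonneg (abs_nonneg _) (nuDensity_pos x).le)
    have h3 := mul_le_mul_of_nonneg_right (hB (-R)) (nuDensity_pos R).le
    have h4 := mul_le_mul_of_nonneg_right (hB R) (nuDensity_pos R).le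
    simp only [← mul_assoc] at h1
    linarith
  rw [hent, integral_nu]
  have hlim : Tendsto (fun R : ℝ => ∫ x in -R..R, g x * h x * nuDensity x) atTop
      (𝓝 (∫ x, g x * h x * nuDensity x)) :=
    intervalIntegral_tendsto_integral (integrable_nu_iff.1 hghi) tendsto_neg_atTop_atBot
      tendsto_id
  have hlim2 : Tendsto (fun R : ℝ => 2 * B * nuDensity R + ∫ x, |deriv g x| ∂nu) atTop
      (𝓝 (2 * B * 0 + ∫ x, |deriv g x| ∂nu)) :=
    (tendsto_nuDensity_atTop.const_mul _).add_const _
  rw [mul_zero, zero_add] at hlim2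
  refine le_of_tendsto_of_tendsto hlim hlim2 ?_
  filter_upwards [eventually_ge_atTop 0] with R hR using hstep R hR

/-- The `L¹` entropy-energy inequality for `nu`. -/
theorem ofReal_entropy_nu_le {g : ℝ → ℝ} (hL : LocallyLipschitz g)
    (hpos : ∀ x, 0 < g x) {B : ℝ} (hB : ∀ x, g x ≤ B) :
    ENNReal.ofReal (entropy nu g) ≤ ∫⁻ x, ‖deriv g x‖ₑ ∂nu := by
  by_cases hfin : ∫⁻ x, ‖deriv g x‖ₑ ∂nu = ∞
  · rw [hfin]; exact le_top
  have hd : Integrable (deriv g) nu :=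
    ⟨(measurable_deriv g).aestronglyMeasurable, lt_top_iff_ne_top.2 hfin⟩
  calc ENNReal.ofReal (entropy nu g) ≤ ENNReal.ofReal (∫ x, |deriv g x| ∂nu) :=
        ENNReal.ofReal_le_ofReal (entropy_nu_le_integral_deriv hL hpos hB hd)
    _ = ∫⁻ x, ‖deriv g x‖ₑ ∂nu := ofReal_integral_norm_eq_lintegral_enorm hd

/-! ### The modified logarithmic Sobolev inequality -/

theorem LocallyLipschitz.ae_differentiableAt_real {f : ℝ → ℝ} (hf : LocallyLipschitz f) :
    ∀ᵐ x, DifferentiableAt ℝ f x := by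
  have h : ∀ n : ℕ, ∀ᵐ x, x ∈ Set.uIcc (-(n : ℝ)) n → DifferentiableAt ℝ f x := fun n => by
    obtain ⟨K, hK⟩ := (hf.locallyLipschitzOn
      (s := Set.uIcc (-(n : ℝ)) n)).exists_lipschitzOnWith_of_compact isCompact_uIcc
    exact hK.absolutelyContinuousOnInterval.ae_differentiableAt
  filter_upwards [ae_all_iff.2 h] with x hx
  obtain ⟨n, hn⟩ := exists_nat_ge |x|
  refine hx n ?_
  rw [Set.uIcc_of_le (by linarith [abs_nonneg x])]
  exact abs_le.1 hn

theorem conditionC_abs : ConditionC (fun x : ℝ => ENNReal.ofReal |x|) where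
  map_zero := by simp
  continuousAt_zero := (ENNReal.continuous_ofReal.comp continuous_abs).continuousAt
  pos x hx := by simpa using hx
  tendsto_top := ENNReal.tendsto_ofReal_atTop.comp tendsto_comap
  left_continuous x t _ := by
    have : Continuous fun s : ℝ => ENNReal.ofReal |s • x| :=
      ENNReal.continuous_ofReal.comp (by fun_prop)
    exact this.continuousWithinAt
  monotone_div x s hs t ht _ := by
    have h : ∀ r ∈ Set.Ioi (0 : ℝ), ENNReal.ofReal |r • x| / ENNReal.ofReal r =
        ENNReal.ofReal |x| := fun r hr => by
      have hr : 0 < r := hr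
      rw [← ENNReal.ofReal_div_of_pos hr, smul_eq_mul, abs_mul, abs_of_pos hr,
        mul_div_cancel_left₀ _ hr.ne']
    simp only [h s hs, h t ht, le_refl]
  symm x := by simp

theorem modifiedLSI_nu_abs : ModifiedLSI nu (fun x : ℝ => ENNReal.ofReal |x|) 2 where
  isProbabilityMeasure := nu_isProbabilityMeasure
  absolutelyContinuous := nu_absolutelyContinuous
  conditionC := conditionC_abs
  pos := two_pos
  inequality f hf hpos hM := by
    obtain ⟨B, hB⟩ := hM
    have hsq : LocallyLipschitz fun x => f x ^ 2 :=
      (ContDiff.locallyLipschitz (𝕂 := ℝ) (f := fun y : ℝ => y ^ 2) (by fun_prop)).comp hf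
    -- The two right-hand sides agree: |(f²)'| = 2 |f'/f| f² wherever f is differentiable, hence
    -- ν-almost everywhere. This is the source of the constant 2.
    refine (ofReal_entropy_nu_le hsq (fun x => pow_pos (hpos x) 2) (B := B ^ 2)
      fun x => pow_le_pow_left₀ (hpos x).le (hB x) 2).trans (le_of_eq ?_)
    rw [← lintegral_const_mul' _ _ ENNReal.ofReal_ne_top]
    refine lintegral_congr_ae ?_
    filter_upwards [nu_absolutelyContinuous.ae_le hf.ae_differentiableAt_real] with x hx
    have hp := hpos x
    rw [gradient_eq_deriv', (hx.hasDerivAt.fun_pow 2).deriv, ← ENNReal.ofReal_mul (abs_nonneg _),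
      ← ENNReal.ofReal_mul zero_le_two, Real.enorm_eq_ofReal_abs, smul_eq_mul,
      abs_mul (f x)⁻¹, abs_of_pos (inv_pos.2 hp)]
    congr 1
    simp only [Nat.cast_ofNat, abs_mul, Nat.abs_ofNat, Nat.add_one_sub_one, pow_one, abs_of_pos hp]
    field_simp

/-! ### Moment growth -/

/-- Hölder with exponents r/(r - 1) and r, then monotonicity of norms on a probability space to pass
from r to p. A bound by the fixed p-norm leaves only 1/r to be integrated later. -/
theorem lintegral_rpow_mul_enorm_le {f d : ℝ → ℝ} (hf : Continuous f) (hd : Measurable d)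
    {ε B : ℝ} (hε : 0 < ε) (hfε : ∀ x, ε ≤ f x) (hfB : ∀ x, f x ≤ B) {r p : ℝ} (hr : 1 < r)
    (hrp : r ≤ p) :
    ∫⁻ x, ENNReal.ofReal (f x ^ (r - 1)) * ‖d x‖ₑ ∂nu ≤
      ENNReal.ofReal ((∫ x, f x ^ r ∂nu) ^ ((r - 1) / r)) *
        eLpNorm d (ENNReal.ofReal p) nu := by
  have hP := nu_isProbabilityMeasure
  have hpos : ∀ x, 0 < f x := fun x => hε.trans_le (hfε x)
  have hr0 : 0 < r := one_pos.trans hr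
  have hq : r.HolderConjugate (r / (r - 1)) := Real.HolderConjugate.conjExponent hr
  have hfm := hf.measurable
  have hfr : Integrable (fun x => f x ^ r) nu :=
    integrable_nu_of_bounded (hf.rpow_const fun x => Or.inl (hpos x).ne') (B := B ^ r) fun x => by
      rw [abs_of_nonneg (Real.rpow_nonneg (hpos x).le r)]
      exact Real.rpow_le_rpow (hpos x).le (hfB x) hr0.le
  have hold := ENNReal.lintegral_mul_le_Lp_mul_Lq nu hq.symm
    (f := fun x => ENNReal.ofReal (f x ^ (r - 1))) (g := fun x => ‖d x‖ₑ)
    (by fun_prop) (by fun_prop)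
  refine hold.trans (mul_le_mul' (le_of_eq ?_) ?_)
  · have h1 : ∀ x, ENNReal.ofReal (f x ^ (r - 1)) ^ (r / (r - 1)) = ENNReal.ofReal (f x ^ r) :=
      fun x => by
        rw [ENNReal.ofReal_rpow_of_pos (Real.rpow_pos_of_pos (hpos x) _),
          ← Real.rpow_mul (hpos x).le, mul_div_cancel₀ _ (sub_pos.2 hr).ne']
    simp only [h1]
    have hI := integral_nu_pos hfr fun x => Real.rpow_pos_of_pos (hpos x) r
    rw [← ofReal_integral_eq_lintegral_ofReal hfr
      (ae_of_all _ fun x => Real.rpow_nonneg (hpos x).le r),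
      ENNReal.ofReal_rpow_of_pos hI, one_div_div]
  · have h2 : (∫⁻ x, ‖d x‖ₑ ^ r ∂nu) ^ (1 / r) = eLpNorm d (ENNReal.ofReal r) nu := by
      rw [eLpNorm_eq_lintegral_rpow_enorm_toReal (by simpa using hr0) ENNReal.ofReal_ne_top,
        ENNReal.toReal_ofReal hr0.le]
    rw [h2]
    exact eLpNorm_le_eLpNorm_of_exponent_le (ENNReal.ofReal_le_ofReal hrp)
      hd.aestronglyMeasurable

theorem entropy_rpow_nu_le {f : ℝ → ℝ} (hf : LocallyLipschitz f)
    {ε B : ℝ} (hε : 0 < ε) (hfε : ∀ x, ε ≤ f x) (hfB : ∀ x, f x ≤ B) {r p : ℝ} (hr : 1 < r)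
    (hrp : r ≤ p) (hfin : eLpNorm (deriv f) (ENNReal.ofReal p) nu ≠ ∞) :
    entropy nu (fun x => f x ^ r) ≤
      r * (∫ x, f x ^ r ∂nu) ^ ((r - 1) / r) *
        (eLpNorm (deriv f) (ENNReal.ofReal p) nu).toReal := by
  have hpos : ∀ x, 0 < f x := fun x => hε.trans_le (hfε x)
  have hr0 : 0 < r := one_pos.trans hr
  have hI : 0 ≤ ∫ x, f x ^ r ∂nu :=
    integral_nonneg fun x => Real.rpow_nonneg (hpos x).le r
  have hL : LocallyLipschitz fun x => f x ^ r :=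
    (ContDiff.locallyLipschitz (𝕂 := ℝ) (f := fun y : ℝ => y ^ r)
      (Real.contDiff_rpow_const_of_le (by exact_mod_cast hr.le))).comp hf
  have hnn : 0 ≤ r * (∫ x, f x ^ r ∂nu) ^ ((r - 1) / r) :=
    mul_nonneg hr0.le (Real.rpow_nonneg hI _)
  rw [← ENNReal.ofReal_le_ofReal_iff (mul_nonneg hnn ENNReal.toReal_nonneg),
    ENNReal.ofReal_mul hnn, ENNReal.ofReal_toReal hfin, ENNReal.ofReal_mul hr0.le, mul_assoc]
  refine (ofReal_entropy_nu_le hL (fun x => Real.rpow_pos_of_pos (hpos x) r) (B := B ^ r)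
    fun x => Real.rpow_le_rpow (hpos x).le (hfB x) hr0.le).trans ?_
  calc ∫⁻ x, ‖deriv (fun x => f x ^ r) x‖ₑ ∂nu
      = ENNReal.ofReal r * ∫⁻ x, ENNReal.ofReal (f x ^ (r - 1)) * ‖deriv f x‖ₑ ∂nu := by
        rw [← lintegral_const_mul' _ _ ENNReal.ofReal_ne_top]
        refine lintegral_congr_ae ?_
        filter_upwards [nu_absolutelyContinuous.ae_le hf.ae_differentiableAt_real] with x hx
        rw [(hx.hasDerivAt.rpow_const (Or.inl (hpos x).ne')).deriv, enorm_mul, enorm_mul,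
          Real.enorm_of_nonneg hr0.le, Real.enorm_of_nonneg (Real.rpow_nonneg (hpos x).le _)]
        ring
    _ ≤ _ := by
        gcongr
        exact lintegral_rpow_mul_enorm_le hf.continuous (measurable_deriv f) hε hfε hfB hr hrp

/-- The moments of f are the moment generating function of log f, which is bounded, so they are
differentiable in r. The entropy bound makes ‖f‖_r - D log r nonincreasing on [1, p]; its values at
the endpoints are compared. -/
theorem rpow_integral_rpow_nu_le_of_bounded {f : ℝ → ℝ} (hf : LocallyLipschitz f)
    {ε B : ℝ} (hε : 0 < ε) (hfε : ∀ x, ε ≤ f x) (hfB : ∀ x, f x ≤ B) {p : ℝ} (hp : 1 < p)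
    (hfin : eLpNorm (deriv f) (ENNReal.ofReal p) nu ≠ ∞) :
    (∫ x, f x ^ p ∂nu) ^ p⁻¹ ≤
      ∫ x, f x ∂nu + Real.log p * (eLpNorm (deriv f) (ENNReal.ofReal p) nu).toReal := by
  have hP := nu_isProbabilityMeasure
  have hpos : ∀ x, 0 < f x := fun x => hε.trans_le (hfε x)
  set D := (eLpNorm (deriv f) (ENNReal.ofReal p) nu).toReal with hD
  set u : ℝ → ℝ := fun x => Real.log (f x) with hu
  have huc : Continuous u := hf.continuous.log fun x => (hpos x).ne'
  have hexp : ∀ r x, Real.exp (r * u x) = f x ^ r := fun r x => by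
    rw [Real.rpow_def_of_pos (hpos x), mul_comm]
  have hmgf : ∀ r, mgf u nu r = ∫ x, f x ^ r ∂nu := fun r => by simp only [mgf, hexp]
  have hmem : ∀ᵐ x ∂nu, u x ∈ Set.Icc (Real.log ε) (Real.log B) := ae_of_all _ fun x =>
    ⟨Real.log_le_log hε (hfε x), Real.log_le_log (hpos x) (hfB x)⟩
  have hset : integrableExpSet u nu = Set.univ := Set.eq_univ_of_forall fun r =>
    integrable_exp_mul_of_mem_Icc huc.aemeasurable hmem
  have hAd : ∀ r, HasDerivAt (mgf u nu) (∫ x, u x * Real.exp (r * u x) ∂nu) r := fun r =>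
    hasDerivAt_mgf (by rw [hset]; simp)
  have hApos : ∀ r, 0 < mgf u nu r := fun r => mgf_pos (integrable_exp_mul_of_mem_Icc
    huc.aemeasurable hmem)
  -- Φ r is ‖f‖_r, written so that the logarithmic derivative is immediate.
  set Φ : ℝ → ℝ := fun r => Real.exp (Real.log (mgf u nu r) / r) with hΦ
  have hΦd : ∀ r, 0 < r → HasDerivAt Φ (Φ r *
      (((∫ x, u x * Real.exp (r * u x) ∂nu) / mgf u nu r * r - Real.log (mgf u nu r) * 1) /
        r ^ 2)) r :=
    fun r hr => (((hAd r).log (hApos r).ne').div (hasDerivAt_id r) hr.ne').exp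
  have hle : ∀ r, 1 < r → r ≤ p → Φ r *
      (((∫ x, u x * Real.exp (r * u x) ∂nu) / mgf u nu r * r - Real.log (mgf u nu r) * 1) /
        r ^ 2) ≤ D / r := fun r hr hrp => by
    have hr0 : 0 < r := one_pos.trans hr
    have h1 := entropy_rpow_nu_le hf hε hfε hfB hr hrp hfin
    rw [← hmgf, ← hD] at h1
    have h2 : entropy nu (fun x => f x ^ r) =
        r * (∫ x, u x * Real.exp (r * u x) ∂nu) - mgf u nu r * Real.log (mgf u nu r) := by
      rw [entropy, ← hmgf, ← integral_const_mul]
      congr 1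
      refine integral_congr_ae (ae_of_all _ fun x => ?_)
      simp only [hexp]
      rw [Real.log_rpow (hpos x)]
      ring
    have h3 : mgf u nu r ^ ((r - 1) / r) = mgf u nu r / Φ r := by
      have h4 : mgf u nu r / Φ r = Real.exp (Real.log (mgf u nu r) - Real.log (mgf u nu r) / r) := by
        rw [Real.exp_sub, Real.exp_log (hApos r)]
      rw [Real.rpow_def_of_pos (hApos r), h4]
      congr 1
      field_simp
    rw [h2, h3] at h1
    have hA := hApos r
    have hF : 0 < Φ r := Real.exp_pos _
    generalize (∫ x, u x * Real.exp (r * u x) ∂nu) = A' at h1 ⊢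
    generalize Real.log (mgf u nu r) = l at h1 ⊢
    generalize Φ r = F at h1 hF ⊢
    generalize mgf u nu r = A at h1 hA ⊢
    have h4 : F * ((A' / A * r - l * 1) / r ^ 2) = (r * A' - A * l) * (F / (A * r ^ 2)) := by
      field_simp
    rw [h4]
    refine (mul_le_mul_of_nonneg_right h1 (by positivity)).trans (le_of_eq ?_)
    field_simp
  have hGd : ∀ r, 0 < r → HasDerivAt (fun r => Φ r - Real.log r * D) _ r := fun r hr =>
    (hΦd r hr).sub ((Real.hasDerivAt_log hr.ne').mul_const D)
  have hanti : AntitoneOn (fun r => Φ r - Real.log r * D) (Set.Icc 1 p) := by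
    refine antitoneOn_of_deriv_nonpos (convex_Icc 1 p)
      (fun r hr => (hGd r (one_pos.trans_le hr.1)).continuousAt.continuousWithinAt) ?_ ?_
    · rw [interior_Icc]
      exact fun r hr => (hGd r (one_pos.trans hr.1)).differentiableAt.differentiableWithinAt
    · rw [interior_Icc]
      intro r hr
      rw [(hGd r (one_pos.trans hr.1)).deriv, sub_nonpos, ← div_eq_inv_mul]
      exact hle r hr.1 hr.2.le
  have hfinal := hanti ⟨le_rfl, hp.le⟩ ⟨hp.le, le_rfl⟩ hp.le
  simp only [hΦ, Real.log_one, zero_mul, sub_zero, div_one, Real.exp_log (hApos 1)] at hfinal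
  rw [hmgf 1] at hfinal
  simp only [Real.rpow_one] at hfinal
  rw [← hmgf, Real.rpow_def_of_pos (hApos p), ← div_eq_mul_inv]
  linarith

theorem eLpNorm_nu_le_of_bounded {f : ℝ → ℝ} (hf : LocallyLipschitz f)
    {ε B : ℝ} (hε : 0 < ε) (hfε : ∀ x, ε ≤ f x) (hfB : ∀ x, f x ≤ B) {p : ℝ} (hp : 1 < p)
    (hfin : eLpNorm (deriv f) (ENNReal.ofReal p) nu ≠ ∞) :
    eLpNorm f (ENNReal.ofReal p) nu ≤ eLpNorm f 1 nu +
      ENNReal.ofReal (Real.log p) * eLpNorm (deriv f) (ENNReal.ofReal p) nu := by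
  have hP := nu_isProbabilityMeasure
  have hpos : ∀ x, 0 < f x := fun x => hε.trans_le (hfε x)
  have hnorm : ∀ x, ‖f x‖ = f x := fun x => Real.norm_of_nonneg (hpos x).le
  have hp0 : 0 < p := one_pos.trans hp
  have hmem : ∀ q : ℝ≥0∞, MemLp f q nu := fun q =>
    MemLp.of_bound hf.continuous.aestronglyMeasurable B (ae_of_all _ fun x => by
      rw [hnorm]; exact hfB x)
  have h1 := (hmem (ENNReal.ofReal p)).eLpNorm_eq_integral_rpow_norm (by simpa using hp0)
    ENNReal.ofReal_ne_top
  have h2 := (hmem 1).eLpNorm_eq_integral_rpow_norm one_ne_zero ENNReal.one_ne_top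
  simp only [hnorm, ENNReal.toReal_ofReal hp0.le] at h1
  simp only [hnorm, ENNReal.toReal_one, Real.rpow_one, inv_one] at h2
  rw [h1, h2, ← ENNReal.ofReal_toReal hfin, ← ENNReal.ofReal_mul (Real.log_nonneg hp.le),
    ← ENNReal.ofReal_add (integral_nonneg fun x => (hpos x).le)
      (mul_nonneg (Real.log_nonneg hp.le) ENNReal.toReal_nonneg)]
  exact ENNReal.ofReal_le_ofReal (rpow_integral_rpow_nu_le_of_bounded hf hε hfε hfB hp hfin)

/-- The difference quotients of ψ ∘ f are dominated by those of f. Where ψ ∘ f is not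
differentiable, `deriv` takes the value 0, so no chain rule is needed at the kinks of ψ. -/
theorem LipschitzWith.norm_deriv_comp_le {ψ f : ℝ → ℝ} (hψ : LipschitzWith 1 ψ) {x : ℝ}
    (hf : DifferentiableAt ℝ f x) : ‖deriv (ψ ∘ f) x‖ ≤ ‖deriv f x‖ := by
  by_cases hd : DifferentiableAt ℝ (ψ ∘ f) x
  · have h1 := (hasDerivAt_iff_tendsto_slope.1 hd.hasDerivAt).norm
    have h2 := (hasDerivAt_iff_tendsto_slope.1 hf.hasDerivAt).norm
    refine le_of_tendsto_of_tendsto' h1 h2 fun y => ?_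
    simp only [slope_def_module, norm_smul, Function.comp_apply]
    gcongr
    simpa [dist_eq_norm] using hψ.dist_le_mul (f y) (f x)
  · simp [deriv_zero_of_not_differentiableAt hd]

theorem eLpNorm_nu_le {f : ℝ → ℝ} (hf : LocallyLipschitz f) {p : ℝ} (hp : 1 < p) :
    eLpNorm f (ENNReal.ofReal p) nu ≤ eLpNorm f 1 nu +
      ENNReal.ofReal (Real.log p) * eLpNorm (deriv f) (ENNReal.ofReal p) nu := by
  have hP := nu_isProbabilityMeasure
  -- In the infinite case log p > 0 matters, since 0 · ∞ = 0 in `ℝ≥0∞`.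
  by_cases hfin : eLpNorm (deriv f) (ENNReal.ofReal p) nu = ∞
  · rw [hfin, ENNReal.mul_top (by simpa using Real.log_pos hp)]
    simp
  set ε : ℕ → ℝ := fun k => 1 / ((k : ℝ) + 1) with hε
  have hεpos : ∀ k, 0 < ε k := fun k => Nat.one_div_pos_of_nat
  have hεlim : Tendsto ε atTop (𝓝 0) := tendsto_one_div_add_atTop_nhds_zero_nat
  -- A 1-Lipschitz truncation of |y| with values in [ε k, k + ε k]: it meets the two-sided bounds,
  -- does not increase the derivative, and costs only ε k in the L¹ norm.
  set ψ : ℕ → ℝ → ℝ := fun k y => min |y| k + ε k with hψ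
  have hψL : ∀ k, LipschitzWith 1 (ψ k) := fun k => by
    simpa using ((lipschitzWith_one_norm (E := ℝ)).min_const (k : ℝ)).add
      (LipschitzWith.const (ε k))
  have hfm := hf.continuous.aestronglyMeasurable (μ := nu)
  have hψc : ∀ k, LocallyLipschitz (ψ k ∘ f) := fun k => (hψL k).locallyLipschitz.comp hf
  have hderiv : ∀ k, eLpNorm (deriv (ψ k ∘ f)) (ENNReal.ofReal p) nu ≤
      eLpNorm (deriv f) (ENNReal.ofReal p) nu := fun k => by
    refine eLpNorm_mono_ae ?_
    filter_upwards [nu_absolutelyContinuous.ae_le hf.ae_differentiableAt_real] with x hx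
      using (hψL k).norm_deriv_comp_le hx
  have hone : ∀ k, eLpNorm (ψ k ∘ f) 1 nu ≤ eLpNorm f 1 nu + ENNReal.ofReal (ε k) := fun k => by
    calc eLpNorm (ψ k ∘ f) 1 nu ≤ eLpNorm (fun x => ‖f x‖ + ε k) 1 nu := by
          refine eLpNorm_mono fun x => ?_
          have h0 : 0 ≤ min |f x| (k : ℝ) := le_min (abs_nonneg _) k.cast_nonneg
          refine abs_le_abs_of_nonneg (add_nonneg h0 (hεpos k).le) ?_
          exact add_le_add_left (min_le_left _ _) _
      _ ≤ eLpNorm (fun x => ‖f x‖) 1 nu + eLpNorm (fun _ : ℝ => ε k) 1 nu :=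
          eLpNorm_add_le hfm.norm aestronglyMeasurable_const le_rfl
      _ = _ := by
          rw [eLpNorm_norm, eLpNorm_const _ one_ne_zero hP.neZero.out]
          simp [Real.enorm_of_nonneg (hεpos k).le]
  have hstep : ∀ k, eLpNorm (ψ k ∘ f) (ENNReal.ofReal p) nu ≤
      eLpNorm f 1 nu + ENNReal.ofReal (ε k) +
        ENNReal.ofReal (Real.log p) * eLpNorm (deriv f) (ENNReal.ofReal p) nu := fun k => by
    refine (eLpNorm_nu_le_of_bounded (hψc k) (hεpos k) (B := k + ε k) (fun x => ?_) (fun x => ?_)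
      hp (ne_top_of_le_ne_top hfin (hderiv k))).trans ?_
    · exact le_add_of_nonneg_left (le_min (abs_nonneg _) k.cast_nonneg)
    · exact add_le_add_left (min_le_right _ _) _
    · gcongr
      · exact hone k
      · exact hderiv k
  have hlim : ∀ x, Tendsto (fun k => (ψ k ∘ f) x) atTop (𝓝 |f x|) := fun x => by
    have h1 : Tendsto (fun k => |f x| + ε k) atTop (𝓝 (|f x| + 0)) := hεlim.const_add _
    rw [add_zero] at h1
    refine h1.congr' ?_
    obtain ⟨n, hn⟩ := exists_nat_ge |f x|
    filter_upwards [eventually_ge_atTop n] with k hk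
    have : |f x| ≤ k := hn.trans (by exact_mod_cast hk)
    simp [hψ, min_eq_left this]
  have hfatou := Lp.eLpNorm_lim_le_liminf_eLpNorm (p := ENNReal.ofReal p) (μ := nu)
    (fun k => (hψc k).continuous.aestronglyMeasurable) (fun x => |f x|) (ae_of_all _ hlim)
  have hnorm : eLpNorm (fun x => |f x|) (ENNReal.ofReal p) nu = eLpNorm f (ENNReal.ofReal p) nu :=
    eLpNorm_norm f
  rw [hnorm] at hfatou
  have hrhs : Tendsto (fun k => eLpNorm f 1 nu + ENNReal.ofReal (ε k) +
      ENNReal.ofReal (Real.log p) * eLpNorm (deriv f) (ENNReal.ofReal p) nu) atTop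
      (𝓝 (eLpNorm f 1 nu + ENNReal.ofReal 0 +
        ENNReal.ofReal (Real.log p) * eLpNorm (deriv f) (ENNReal.ofReal p) nu)) :=
    ((ENNReal.tendsto_ofReal hεlim).const_add _).add_const _
  rw [ENNReal.ofReal_zero, add_zero] at hrhs
  exact hfatou.trans ((liminf_le_liminf (Eventually.of_forall hstep)).trans hrhs.liminf_eq.le)

/-! ### Tails of ν and optimality of log p -/

theorem nu_le_abs {t : ℝ} (ht : 0 ≤ t) :
    ENNReal.ofReal (Real.exp (1 - Real.exp t)) ≤ nu {x | t ≤ |x|} := by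
  have hP := nu_isProbabilityMeasure
  have h1 : nu (Set.Iic (-t)) = ENNReal.ofReal (1 / 2 * Real.exp (1 - Real.exp t)) := by
    rw [← ofReal_cdf, cdf_nu, nuCDF_of_nonpos (neg_nonpos.2 ht), neg_neg]
    congr 3
    ring
  have h2 : ENNReal.ofReal (1 / 2 * Real.exp (1 - Real.exp t)) = nu (Set.Ioi t) := by
    rw [← Set.compl_Iic, prob_compl_eq_one_sub measurableSet_Iic, ← ofReal_cdf, cdf_nu,
      nuCDF_of_nonneg ht, ← ENNReal.ofReal_one, ← ENNReal.ofReal_sub _ (by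
        have := nuCDF_nonneg t; rwa [nuCDF_of_nonneg ht] at this)]
    congr 1
    rw [show -Real.exp t + 1 = 1 - Real.exp t by ring]
    ring
  calc ENNReal.ofReal (Real.exp (1 - Real.exp t))
      = nu (Set.Iic (-t)) + nu (Set.Ioi t) := by
        rw [h1, ← h2, ← ENNReal.ofReal_add (by positivity) (by positivity)]
        congr 1
        ring
    _ = nu (Set.Iic (-t) ∪ Set.Ioi t) :=
        (measure_union (Set.disjoint_left.2 fun x hx hx' => by
          have h1 : x ≤ -t := hx
          have h2 : t < x := hx'
          linarith) measurableSet_Ioi).symm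
    _ ≤ nu {x | t ≤ |x|} := measure_mono fun x hx => by
        rcases hx with hx | hx
        · have hx : x ≤ -t := hx
          exact (by linarith : t ≤ -x).trans (neg_le_abs x)
        · exact (le_of_lt hx).trans (le_abs_self x)

/-- Chebyshev at level log p, where the tail is at least exp(1 - p): the p-th root of this tail
bound, exp((1 - p)/p), stays above 1/e, which leaves room for the factor 2. -/
theorem ofReal_log_div_le_eLpNorm_id_nu {p : ℝ} (hp : 1 ≤ p) :
    ENNReal.ofReal (Real.log p / (2 * Real.exp 1)) ≤
      eLpNorm (fun x : ℝ => x) (ENNReal.ofReal p) nu := by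
  have hp0 : 0 < p := one_pos.trans_le hp
  have hl : 0 ≤ Real.log p := Real.log_nonneg hp
  have hcheb := mul_meas_ge_le_pow_eLpNorm' nu (f := fun x : ℝ => x) (p := ENNReal.ofReal p)
    (by simpa using hp0) ENNReal.ofReal_ne_top continuous_id.aestronglyMeasurable
    (ENNReal.ofReal (Real.log p))
  rw [ENNReal.toReal_ofReal hp0.le] at hcheb
  have hset : {x : ℝ | ENNReal.ofReal (Real.log p) ≤ ‖x‖ₑ} = {x | Real.log p ≤ |x|} := by
    ext x
    simp only [Set.mem_ofPred_eq, Real.enorm_eq_ofReal_abs]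
    exact ENNReal.ofReal_le_ofReal_iff (abs_nonneg x)
  rw [hset] at hcheb
  have h1 := (mul_le_mul_right (nu_le_abs hl) _).trans hcheb
  rw [Real.exp_log hp0, ENNReal.ofReal_rpow_of_nonneg hl hp0.le,
    ← ENNReal.ofReal_mul (Real.rpow_nonneg hl _)] at h1
  refine le_trans (ENNReal.ofReal_le_ofReal ?_)
    ((ENNReal.rpow_le_rpow_iff hp0).1 ((ENNReal.ofReal_rpow_of_nonneg
      (mul_nonneg hl (Real.exp_pos ((1 - p) / p)).le) hp0.le).trans_le (le_trans (le_of_eq ?_) h1)))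
  · rw [div_eq_mul_inv]
    refine mul_le_mul_of_nonneg_left ?_ hl
    calc (2 * Real.exp 1)⁻¹ ≤ (Real.exp 1)⁻¹ := by
          gcongr
          linarith [Real.exp_pos 1]
      _ = Real.exp (-1) := (Real.exp_neg 1).symm
      _ ≤ Real.exp ((1 - p) / p) := by
          gcongr
          rw [sub_div, div_self hp0.ne']
          linarith [one_div_pos.2 hp0]
  · rw [Real.mul_rpow hl (Real.exp_pos _).le, ← Real.exp_mul, div_mul_cancel₀ _ hp0.ne']

theorem integrable_id_nu : Integrable (fun x : ℝ => x) nu := by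
  rw [integrable_nu_iff]
  -- With y = exp |x|, both |x| ≤ y and 1 + x² ≤ 2y, so |x| (1 + x²) times the density is at most e
  -- y³ exp(-y). The cubic term of the exponential series gives y³ ≤ 6 exp y, whence 6e.
  refine ((integrable_inv_one_add_sq).const_mul (6 * Real.exp 1)).mono'
    (continuous_id.mul continuous_nuDensity).aestronglyMeasurable (ae_of_all _ fun x => ?_)
  have hy := Real.exp_pos |x|
  have h1 : 1 + x ^ 2 ≤ 2 * Real.exp |x| := by
    have := Real.quadratic_le_exp_of_nonneg (abs_nonneg x)
    rw [sq_abs] at this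
    nlinarith [abs_nonneg x]
  have h2 : |x| ≤ Real.exp |x| := by linarith [Real.add_one_le_exp |x|]
  have h3 : Real.exp |x| ^ 3 ≤ 6 * Real.exp (Real.exp |x|) := by
    have := Real.pow_div_factorial_le_exp (Real.exp |x|) hy.le 3
    norm_num [Nat.factorial] at this
    linarith
  rw [norm_mul, Real.norm_eq_abs, Real.norm_of_nonneg (nuDensity_pos x).le, ← div_eq_mul_inv,
    le_div_iff₀ (by positivity), nuDensity,
    show |x| + 1 - Real.exp |x| = |x| + 1 + -Real.exp |x| by ring, Real.exp_add, Real.exp_add,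
    Real.exp_neg]
  calc |x| * (1 / 2 * (Real.exp |x| * Real.exp 1 * (Real.exp (Real.exp |x|))⁻¹)) * (1 + x ^ 2)
      ≤ Real.exp |x| * (1 / 2 * (Real.exp |x| * Real.exp 1 * (Real.exp (Real.exp |x|))⁻¹)) *
          (2 * Real.exp |x|) := by gcongr
    _ = Real.exp |x| ^ 3 * Real.exp 1 * (Real.exp (Real.exp |x|))⁻¹ := by ring
    _ ≤ 6 * Real.exp (Real.exp |x|) * Real.exp 1 * (Real.exp (Real.exp |x|))⁻¹ := by gcongr
    _ = 6 * Real.exp 1 := by field_simp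

theorem isBigO_log_of_eLpNorm_nu_le (C : ℝ≥0) (c : ℝ → ℝ≥0)
    (h : ∀ᶠ p : ℝ in atTop, eLpNorm (fun x : ℝ => x) (ENNReal.ofReal p) nu ≤
      C * eLpNorm (fun x : ℝ => x) 1 nu +
        c p * eLpNorm (deriv fun x : ℝ => x) (ENNReal.ofReal p) nu) :
    Real.log =O[atTop] (fun p => (c p : ℝ)) := by
  have hP := nu_isProbabilityMeasure
  set m := (eLpNorm (fun x : ℝ => x) 1 nu).toReal with hm
  have hmtop : eLpNorm (fun x : ℝ => x) 1 nu ≠ ∞ :=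
    (memLp_one_iff_integrable.2 integrable_id_nu).eLpNorm_ne_top
  -- For such p, log p ≤ 2e (C m + c p) and 2e C m ≤ (log p)/2; absorbing this term doubles 2e to
  -- 4e.
  have hlarge := Real.tendsto_log_atTop.eventually_ge_atTop (4 * Real.exp 1 * (C * m))
  refine IsBigO.of_bound (4 * Real.exp 1) ?_
  filter_upwards [h, hlarge, eventually_ge_atTop 1] with p hp hpl hp1
  have hp0 : 0 < p := one_pos.trans_le hp1
  have hl : 0 ≤ Real.log p := Real.log_nonneg hp1
  have h1 := (ofReal_log_div_le_eLpNorm_id_nu hp1).trans hp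
  have hd : eLpNorm (deriv fun x : ℝ => x) (ENNReal.ofReal p) nu = 1 := by
    rw [show (deriv fun x : ℝ => x) = fun _ => (1 : ℝ) from deriv_id',
      eLpNorm_const _ (by simpa using hp0) hP.neZero.out]
    simp
  rw [hd, mul_one, ← ENNReal.ofReal_toReal hmtop, ← hm, ← ENNReal.ofReal_coe_nnreal,
    ← ENNReal.ofReal_coe_nnreal (p := c p), ← ENNReal.ofReal_mul C.coe_nonneg,
    ← ENNReal.ofReal_add (mul_nonneg C.coe_nonneg ENNReal.toReal_nonneg) (c p).coe_nonneg,
    ENNReal.ofReal_le_ofReal_iff (add_nonneg (mul_nonneg C.coe_nonneg ENNReal.toReal_nonneg) (c p).coe_nonneg),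
    div_le_iff₀ (by positivity)] at h1
  rw [Real.norm_of_nonneg hl, Real.norm_of_nonneg (c p).coe_nonneg]
  nlinarith

theorem mainTheorem12 :
    ModifiedLSI nu (fun x : ℝ => ENNReal.ofReal |x|) 2 ∧
    (∀ f : ℝ → ℝ, LocallyLipschitz f → ∀ p : ℝ, 1 < p →
      eLpNorm f (ENNReal.ofReal p) nu ≤
        eLpNorm f 1 nu + ENNReal.ofReal (Real.log p) * eLpNorm (deriv f) (ENNReal.ofReal p) nu) ∧
    (∀ p : ℝ, 1 ≤ p →
      ENNReal.ofReal (Real.log p / (2 * Real.exp 1)) ≤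
        eLpNorm (fun x : ℝ => x) (ENNReal.ofReal p) nu) ∧
    -- sharpness of the order `log p` as `p → ∞`
    (∀ (C : ℝ≥0) (c : ℝ → ℝ≥0),
      (∀ᶠ p : ℝ in atTop, ∀ f : ℝ → ℝ, LocallyLipschitz f →
        eLpNorm f (ENNReal.ofReal p) nu ≤
          C * eLpNorm f 1 nu + c p * eLpNorm (deriv f) (ENNReal.ofReal p) nu) →
      Real.log =O[atTop] (fun p => (c p : ℝ))) :=
  ⟨modifiedLSI_nu_abs, fun _ hf _ hp => eLpNorm_nu_le hf hp,
    fun _ hp => ofReal_log_div_le_eLpNorm_id_nu hp, fun C c h =>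
    isBigO_log_of_eLpNorm_nu_le C c (h.mono fun _ hp => hp _ LocallyLipschitz.id)⟩
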